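/- Let $\mathbb K$ be $\mathbb R$ or $\mathbb C$, let $w$ be the space of all sequences $x=(x_k)_{k\ge 0}$ in $\mathbb K$, and put $\mathbb N=\{1,2,\dots\}$. Let $p=(p_k)_{k\ge0}$ and $q=(q_k)_{k\ge0}$ be bounded sequences of strictly positive real numbers, and put $$c_0(q)=\{x\in w:\lim_k|x_k|^{q_k}=0\},\quad c(q)=\{x\in w:\exists\, l\in\mathbb K,\ \lim_k|x_k-l|^{q_k}=0\},\quad l_\infty(q)=\{x\in w:\sup_k|x_k|^{q_k}<\infty\}.$$ Let $r,s,t\in w$ with $r_n\ne0$ and $t_n\neq 0$ for all $n$ and $s_0\ne0$, and let $$c_0(r,s,t,p;\Delta)=\Big\{x\in w:\Big(\frac1{r_n}\sum_{k=0}^n s_{n-k}t_k(x_k-x_{k-1})\Big)_n\in c_0(p)\Big\},\qquad x_{-1}=0 .$$ Its $\beta$-dual $[c_0(r,s,t,p;\Delta)]^\beta$ is the set of all $a\in w$ such that $\sum_k a_kx_k$ converges for every $x\in c_0(r,s,t,p;\Delta)$. For sets $U,V\subseteq w$, $(U,V)$ is the class of infinite matrices $A=(a_{nk})_{n,k\ge0}$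 over $\mathbb K$ such that for every $x\in U$ all the series $(Ax)_n=\sum_{k=0}^\infty a_{nk}x_k$ converge and $Ax\in V$. Put $D^{(s)}_0=1/s_0$ and, for $n\ge1$, $D^{(s)}_n=s_0^{-(n+1)}\det(s_{i-j+1})_{1\le i,j\le n}$, where $s_m=0$ for $m<0$. For an infinite matrix $A=(a_{nk})$ over $\mathbb K$ put $$\tilde e_{nk}=\lim_{m\to\infty} r_k\bigg[\frac{a_{nk}}{s_0t_k}+\Big(\frac{D^{(s)}_0}{t_k}-\frac{D^{(s)}_1}{t_{k+1}}\Big)\sum_{j=k+1}^m a_{nj}+\sum_{l=k+2}^m(-1)^{l-k}\frac{D^{(s)}_{l-k}}{t_l}\sum_{j=l}^m a_{nj}\bigg];$$ this limit exists for all $k$ whenever $(a_{nk})_k\in[c_0(r,s,t,p;\Delta)]^\beta$. Then: (a) $A\in(c_0(r,s,t,p;\Delta),c_0(q))$ if and only if $(a_{nk})_k\in[c_0(r,s,t,p;\Delta)]^\beta$ for every $n$ and $$\lim_n|\tilde e_{nk}|^{q_n}=0\ \text{ for all }k,\qquad \forall L\in\mathbb N\ \exists N\in\mathbb N:\ \sup_n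 L^{1/q_n}\sum_k|\tilde e_{nk}|N^{-1/p_k}<\infty .$$ (b) $A\in(c_0(r,s,t,p;\Delta),c(q))$ if and only if $(a_{nk})_k\in[c_0(r,s,t,p;\Delta)]^\beta$ for every $n$ and $$\exists(\alpha_k)\in w:\ \lim_n|\tilde e_{nk}-\alpha_k|^{q_n}=0\ \text{ for all }k,\qquad \exists N\in\mathbb N:\ \sup_n\sum_k|\tilde e_{nk}|N^{-1/p_k}<\infty,$$ $$\exists(\alpha_k)\in w\ \forall L\in\mathbb N\ \exists N\in\mathbb N:\ \sup_n L^{1/q_n}\sum_k|\tilde e_{nk}-\alpha_k|N^{-1/p_k}<\infty .$$ (c) $A\in(c_0(r,s,t,p;\Delta),l_\infty(q))$ if and only if $(a_{nk})_k\in[c_0(r,s,t,p;\Delta)]^\beta$ for every $n$ and $$\exists N\in\mathbb N:\ \sup_n\Big(\sum_k|\tilde e_{nk}|N^{-1/p_k}\Big)^{q_n}<\infty .$$ -/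

import Mathlib

open Filter Topology
open scoped ENNReal

noncomputable section

namespace GeneralizedMeans

variable {𝕜 : Type*} [RCLike 𝕜]

/-- Maddox's space `c₀(p)`. -/
def maddoxC0 (𝕜 : Type*) [RCLike 𝕜] (p : ℕ → ℝ) : Set (ℕ → 𝕜) :=
  {x | Tendsto (fun k => ‖x k‖ ^ p k) atTop (𝓝 0)}

/-- Maddox's space `c(p)`. -/
def maddoxC (𝕜 : Type*) [RCLike 𝕜] (p : ℕ → ℝ) : Set (ℕ → 𝕜) :=
  {x | ∃ l : 𝕜, Tendsto (fun k => ‖x k - l‖ ^ p k) atTop (𝓝 0)}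

/-- Maddox's space `l_∞(p)`. -/
def maddoxLinf (𝕜 : Type*) [RCLike 𝕜] (p : ℕ → ℝ) : Set (ℕ → 𝕜) :=
  {x | BddAbove (Set.range fun k => ‖x k‖ ^ p k)}

/-- The space `cs` of (conditionally) convergent series. -/
def convSeries (𝕜 : Type*) [RCLike 𝕜] : Set (ℕ → 𝕜) :=
  {x | ∃ l : 𝕜, Tendsto (fun m => ∑ k ∈ Finset.range m, x k) atTop (𝓝 l)}

/-- The multiplier space `M(U, V)`. -/
def multiplier (U V : Set (ℕ → 𝕜)) : Set (ℕ → 𝕜) :=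
  {a | ∀ u ∈ U, (fun k => a k * u k) ∈ V}

/-- The β-dual `U^β = M(U, cs)`. -/
def betaDual (U : Set (ℕ → 𝕜)) : Set (ℕ → 𝕜) := multiplier U (convSeries 𝕜)

/-- `A x` exists and equals `z`: every series `∑ₖ a_{nk} xₖ` converges, with sum `zₙ`. -/
def IsTransform (A : ℕ → ℕ → 𝕜) (x z : ℕ → 𝕜) : Prop :=
  ∀ n, Tendsto (fun m => ∑ k ∈ Finset.range m, A n k * x k) atTop (𝓝 (z n))

/-- The class `(U, V)` of infinite matrices that map `U` into `V`. -/
def matrixClass (U V : Set (ℕ → 𝕜)) : Set (ℕ → ℕ → 𝕜) :=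
  {A | ∀ x ∈ U, ∃ z ∈ V, IsTransform A x z}

/-- The difference operator, with the convention `x₋₁ = 0`. -/
def diff (x : ℕ → 𝕜) : ℕ → 𝕜
  | 0 => x 0
  | k + 1 => x (k + 1) - x k

/-- The generalized means `(1 / rₙ) ∑_{k ≤ n} s_{n-k} tₖ xₖ` of `x`. -/
def genMean (r s t x : ℕ → 𝕜) (n : ℕ) : 𝕜 :=
  1 / r n * ∑ k ∈ Finset.range (n + 1), s (n - k) * t k * x k

/-- The space `X(r, s, t; Δ)`; for `X = c₀(p)` this is `c₀(r, s, t, p; Δ)`. -/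
def meanDiffSpace (r s t : ℕ → 𝕜) (X : Set (ℕ → 𝕜)) : Set (ℕ → 𝕜) :=
  {x | genMean r s t (diff x) ∈ X}

/-- `Dₙ^{(s)}`: the `n × n` determinant with entry `s_{i-j+1}` in row `i`, column `j`
(zero for `j > i + 1`), divided by `s₀^{n+1}`; for `n = 0` it is `1 / s₀`. -/
def Dcoef (s : ℕ → 𝕜) (n : ℕ) : 𝕜 :=
  1 / s 0 ^ (n + 1) *
    (Matrix.of fun i j : Fin n =>
      if (j : ℕ) ≤ (i : ℕ) + 1 then s ((i : ℕ) + 1 - (j : ℕ)) else 0).det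

/-- The triangle `E = (e_{mk})` attached to a sequence `a`. -/
def Emat (r s t a : ℕ → 𝕜) (m k : ℕ) : 𝕜 :=
  if k ≤ m then
    r k * (a k / (s 0 * t k)
      + (Dcoef s 0 / t k - Dcoef s 1 / t (k + 1)) * ∑ j ∈ Finset.Icc (k + 1) m, a j
      + ∑ l ∈ Finset.Icc (k + 2) m,
          (-1) ^ (l - k) * (Dcoef s (l - k) / t l) * ∑ j ∈ Finset.Icc l m, a j)
  else 0

/-- The matrix `Ẽ = (ẽ_{nk})` of `A`: `ẽ_{nk}` is the limit, as `m → ∞`, of the entries `e_{mk}`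
of the triangle `E` attached to the `n`-th row of `A`. The limit exists if that row lies in the
β-dual of `c₀(r, s, t, p; Δ)`; `limUnder` has an arbitrary value if it does not exist. -/
def Etilde (r s t : ℕ → 𝕜) (A : ℕ → ℕ → 𝕜) (n k : ℕ) : 𝕜 :=
  limUnder atTop fun m => Emat r s t (A n) m k

/-- `limₙ |a_{nk}|^{qₙ} = 0` for all `k`. -/
def CondColNull (q : ℕ → ℝ) (A : ℕ → ℕ → 𝕜) : Prop :=
  ∀ k, Tendsto (fun n => ‖A n k‖ ^ q n) atTop (𝓝 0)

/-- `∀ L ∃ N: supₙ L^{1/qₙ} ∑ₖ |a_{nk}| N^{-1/pₖ} < ∞`. -/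
def CondRowNull (p q : ℕ → ℝ) (A : ℕ → ℕ → 𝕜) : Prop :=
  ∀ L : ℕ, 1 ≤ L → ∃ N : ℕ, 1 ≤ N ∧
    (⨆ n, (L : ℝ≥0∞) ^ (1 / q n) * ∑' k, ‖A n k‖ₑ * (N : ℝ≥0∞) ^ (-(1 / p k))) < ⊤

/-- `∃ (αₖ): limₙ |a_{nk} - αₖ|^{qₙ} = 0` for all `k`. -/
def CondColConv (q : ℕ → ℝ) (A : ℕ → ℕ → 𝕜) : Prop :=
  ∃ α : ℕ → 𝕜, CondColNull q fun n k => A n k - α k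

/-- `∃ N: supₙ ∑ₖ |a_{nk}| N^{-1/pₖ} < ∞`. -/
def CondRowBdd (p : ℕ → ℝ) (A : ℕ → ℕ → 𝕜) : Prop :=
  ∃ N : ℕ, 1 ≤ N ∧ (⨆ n, ∑' k, ‖A n k‖ₑ * (N : ℝ≥0∞) ^ (-(1 / p k))) < ⊤

/-- `∃ (αₖ) ∀ L ∃ N: supₙ L^{1/qₙ} ∑ₖ |a_{nk} - αₖ| N^{-1/pₖ} < ∞`. -/
def CondRowConv (p q : ℕ → ℝ) (A : ℕ → ℕ → 𝕜) : Prop :=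
  ∃ α : ℕ → 𝕜, CondRowNull p q fun n k => A n k - α k

/-- `∃ N: supₙ (∑ₖ |a_{nk}| N^{-1/pₖ})^{qₙ} < ∞`. -/
def CondRowPowBdd (p q : ℕ → ℝ) (A : ℕ → ℕ → 𝕜) : Prop :=
  ∃ N : ℕ, 1 ≤ N ∧ (⨆ n, (∑' k, ‖A n k‖ₑ * (N : ℝ≥0∞) ^ (-(1 / p k))) ^ q n) < ⊤

end GeneralizedMeans

end

open GeneralizedMeans

namespace GeneralizedMeans

variable {𝕜 : Type*} [RCLike 𝕜]

/-! ### Inverting the generalized means -/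

/-! The map sending `x` to the generalized means `y` of its differences is a bijection onto `c₀(p)`:
the means are a convolution with `s`, so they are inverted by the reciprocal power series, whose
coefficients are `(-1)ⁿ Dₙ`. Substituting the inverse and summing by parts gives `∑_{k ≤ m} aₖ xₖ =
∑ₖ e_{mk} yₖ` with the triangle `Emat`. If `a` is in the β-dual, this triangle maps `c₀(p)` into the
convergent sequences. Unit vectors then give the column limits, uniform boundedness gives a weight
`N^{-1/pₖ}` under which the row sums are bounded in `m`, and together they give `∑ aₖ xₖ = ∑ ẽₖ yₖ`
(`betaDual_spec`). So, for rows in the β-dual, everything reduces to deciding when `Ẽ` maps `c₀(p)`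
into `V`.

For bounded `p`, `c₀(p)` is the intersection over `N` of the null sequences weighted by `N^{1/pₖ}`
(`mem_maddoxC0_iff`), hence a Fréchet space. Necessity of the row conditions is a Baire category
argument there (`exists_forall_row_le`); sufficiency comes from splitting a series into a finite
head and a tail small in the weighted norm. -/

/-- The coefficients `(-1)ⁿ Dₙ` are those of the inverse of the power series `∑ sₙ Xⁿ`. -/
theorem neg_one_pow_mul_Dcoef (s : ℕ → 𝕜) (hs : s 0 ≠ 0) (n : ℕ) :
    (-1) ^ n * Dcoef s n = PowerSeries.coeff n (PowerSeries.mk s)⁻¹ := by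
  set c : ℕ → 𝕜 := fun i => PowerSeries.coeff i (PowerSeries.mk s)⁻¹ with hc
  let T : Matrix (Fin (n + 1)) (Fin (n + 1)) 𝕜 :=
    Matrix.of fun i j => if (j : ℕ) ≤ i then s (i - j) else 0
  have hdet : T.det = s 0 ^ (n + 1) := by
    rw [Matrix.det_of_isLowerTriangular]
    · simp [T]
    · intro i j hij
      have : (i : ℕ) < j := hij
      simp only [T, Matrix.of_apply]
      rw [if_neg this.not_ge]
  have hmul : T.mulVec (fun i => c i) = Pi.single 0 1 := by
    ext i
    have h1 : PowerSeries.mk s * (PowerSeries.mk s)⁻¹ = 1 :=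
      PowerSeries.mul_inv_cancel _ (by simpa using hs)
    have h2 := congrArg (PowerSeries.coeff (i : ℕ)) h1
    rw [mul_comm, PowerSeries.coeff_mul,
      Finset.Nat.sum_antidiagonal_eq_sum_range_succ
        (fun a b => PowerSeries.coeff a (PowerSeries.mk s)⁻¹ *
          PowerSeries.coeff b (PowerSeries.mk s)), PowerSeries.coeff_one] at h2
    have h3 : T.mulVec (fun i => c i) i
        = ∑ j ∈ Finset.range (n + 1), (if j ≤ (i : ℕ) then s (i - j) * c j else 0) := by
      rw [Finset.sum_range]
      simp [T, Matrix.mulVec, dotProduct, ite_mul]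
    rw [h3, ← Finset.sum_filter]
    have h4 : (Finset.range (n + 1)).filter (· ≤ (i : ℕ)) = Finset.range (i + 1) := by
      ext j
      simp only [Finset.mem_filter, Finset.mem_range]
      omega
    rw [h4]
    simp only [PowerSeries.coeff_mk] at h2
    rw [Pi.single_apply]
    simp only [hc, Fin.ext_iff, Fin.val_zero]
    rw [← h2]
    exact Finset.sum_congr rfl fun j _ => mul_comm _ _
  -- Cramer's rule: `T c` is the first unit vector, so `det T * c n` is the adjugate entry at `(n,
  -- 0)`. It is the signed minor without row `0` and the last column, which is the determinant in
  -- `Dcoef`.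
  have hadj := congrArg (fun v => T.adjugate.mulVec v (Fin.last n)) hmul
  simp only [Matrix.mulVec_mulVec, Matrix.adjugate_mul, Matrix.smul_mulVec, Matrix.one_mulVec,
    Matrix.mulVec_single_one, Matrix.col_apply, Pi.smul_apply, smul_eq_mul, hdet,
    Fin.val_last] at hadj
  rw [Matrix.adjugate_fin_succ_eq_det_submatrix] at hadj
  have hH : T.submatrix (Fin.succAbove 0) (Fin.succAbove (Fin.last n))
      = Matrix.of fun i j : Fin n =>
        if (j : ℕ) ≤ (i : ℕ) + 1 then s ((i : ℕ) + 1 - (j : ℕ)) else 0 := by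
    ext i j
    simp only [T, Matrix.submatrix_apply, Matrix.of_apply, Fin.zero_succAbove, Fin.succAbove_last,
      Fin.val_succ, Fin.val_castSucc]
  rw [hH] at hadj
  have hs' : s 0 ^ (n + 1) ≠ 0 := pow_ne_zero _ hs
  change _ = c n
  rw [Dcoef, ← mul_right_inj' hs', hadj]
  simp only [Fin.val_zero, Fin.val_last, zero_add]
  field_simp

theorem sum_range_diff (x : ℕ → 𝕜) (j : ℕ) : ∑ l ∈ Finset.range (j + 1), diff x l = x j := by
  induction j with
  | zero => simp [diff]
  | succ j ih => rw [Finset.sum_range_succ, ih]; simp [diff]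

/-- As power series in `X`, `∑ rₖ yₖ Xᵏ` is the product of `∑ tₖ dₖ Xᵏ` and `∑ sₖ Xᵏ`; the last
factor is invertible since `s 0 ≠ 0`. -/
theorem genMean_eq_iff (r s t : ℕ → 𝕜) (hr : ∀ n, r n ≠ 0) (hs : s 0 ≠ 0) (ht : ∀ n, t n ≠ 0)
    (d y : ℕ → 𝕜) :
    genMean r s t d = y ↔ ∀ l, d l =
      ∑ k ∈ Finset.range (l + 1), (-1) ^ (l - k) * (Dcoef s (l - k) / t l) * (r k * y k) := by
  have hs' : PowerSeries.constantCoeff (PowerSeries.mk s) ≠ 0 := by simpa using hs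
  have h1 : genMean r s t d = y ↔
      PowerSeries.mk (fun k => t k * d k) * PowerSeries.mk s
        = PowerSeries.mk fun k => r k * y k := by
    rw [funext_iff, PowerSeries.ext_iff]
    refine forall_congr' fun n => ?_
    rw [PowerSeries.coeff_mul, Finset.Nat.sum_antidiagonal_eq_sum_range_succ
        (fun a b => PowerSeries.coeff a (PowerSeries.mk fun k => t k * d k) *
          PowerSeries.coeff b (PowerSeries.mk s))]
    simp only [PowerSeries.coeff_mk, genMean]
    rw [one_div_mul_eq_div, div_eq_iff (hr n), mul_comm (y n)]
    exact Eq.congr (Finset.sum_congr rfl fun k _ => by ring) rfl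
  rw [h1, ← PowerSeries.eq_mul_inv_iff_mul_eq hs', PowerSeries.ext_iff]
  refine forall_congr' fun n => ?_
  rw [PowerSeries.coeff_mul, Finset.Nat.sum_antidiagonal_eq_sum_range_succ
        (fun a b => PowerSeries.coeff a (PowerSeries.mk fun k => r k * y k) *
          PowerSeries.coeff b (PowerSeries.mk s)⁻¹)]
  simp only [PowerSeries.coeff_mk, ← neg_one_pow_mul_Dcoef s hs]
  rw [mul_comm (t n), ← eq_div_iff (ht n), Finset.sum_div]
  refine Eq.congr rfl (Finset.sum_congr rfl fun k _ => ?_)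
  ring

theorem exists_genMean_diff_eq (r s t : ℕ → 𝕜) (hr : ∀ n, r n ≠ 0) (hs : s 0 ≠ 0)
    (ht : ∀ n, t n ≠ 0) (y : ℕ → 𝕜) : ∃ x, genMean r s t (diff x) = y := by
  let d : ℕ → 𝕜 := fun l =>
    ∑ k ∈ Finset.range (l + 1), (-1) ^ (l - k) * (Dcoef s (l - k) / t l) * (r k * y k)
  refine ⟨fun j => ∑ l ∈ Finset.range (j + 1), d l, ?_⟩
  rw [genMean_eq_iff r s t hr hs ht]
  rintro (_ | l)
  · simp [diff, d]
  · simp only [diff]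
    rw [Finset.sum_range_succ _ (l + 1), add_sub_cancel_left]

theorem Emat_eq (r s t a : ℕ → 𝕜) {m k : ℕ} (h : k ≤ m) :
    Emat r s t a m k = r k * ∑ l ∈ Finset.Icc k m,
      (-1) ^ (l - k) * (Dcoef s (l - k) / t l) * ∑ j ∈ Finset.Icc l m, a j := by
  have hI : ∀ (f : ℕ → 𝕜) {a b : ℕ}, a ≤ b →
      ∑ j ∈ Finset.Icc a b, f j = f a + ∑ j ∈ Finset.Icc (a + 1) b, f j := fun f a b hab => by
    rw [← Finset.add_sum_Ioc_eq_sum_Icc hab]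
    congr 2
    ext
    simp
  have hD : a k / (s 0 * t k) = Dcoef s 0 / t k * a k := by
    simp [Dcoef, div_eq_mul_inv]
    ring
  rw [Emat, if_pos h, hI _ h, hI a h, hD]
  -- For `k = m` there is no term `l = k + 1`, but the term with `Dcoef s 1` vanishes too, its inner
  -- sum being empty.
  rcases h.eq_or_lt with rfl | h'
  · simp
  · rw [hI (fun l => (-1) ^ (l - k) * (Dcoef s (l - k) / t l) * ∑ j ∈ Finset.Icc l m, a j)
      (show k + 1 ≤ m from h')]
    simp only [Nat.sub_self, Nat.add_sub_cancel_left, pow_zero, pow_one]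
    ring

/-- Two exchanges of summation: first `x` is written as a sum of its differences, then each
difference as a combination of the means. -/
theorem sum_mul_eq_sum_Emat_mul (r s t : ℕ → 𝕜) (hr : ∀ n, r n ≠ 0) (hs : s 0 ≠ 0)
    (ht : ∀ n, t n ≠ 0) (a x : ℕ → 𝕜) (m : ℕ) :
    ∑ k ∈ Finset.range (m + 1), a k * x k =
      ∑ k ∈ Finset.range (m + 1), Emat r s t a m k * genMean r s t (diff x) k := by
  set y := genMean r s t (diff x) with hy
  have hd := (genMean_eq_iff r s t hr hs ht (diff x) y).1 rfl
  have h1 : ∑ j ∈ Finset.range (m + 1), a j * x j =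
      ∑ l ∈ Finset.range (m + 1), diff x l * ∑ j ∈ Finset.Icc l m, a j := by
    simp_rw [← sum_range_diff x, Finset.mul_sum]
    rw [Finset.sum_comm' (t' := Finset.range (m + 1)) (s' := fun l => Finset.Icc l m)]
    · exact Finset.sum_congr rfl fun l _ => Finset.sum_congr rfl fun j _ => mul_comm _ _
    · intro j l
      simp only [Finset.mem_range, Finset.mem_Icc]
      omega
  rw [h1]
  simp_rw [hd, Finset.sum_mul]
  rw [Finset.sum_comm' (t' := Finset.range (m + 1)) (s' := fun k => Finset.Icc k m)]
  · refine Finset.sum_congr rfl fun k hk => ?_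
    rw [Emat_eq r s t a (Nat.lt_succ_iff.1 (Finset.mem_range.1 hk)), Finset.mul_sum,
      Finset.sum_mul]
    exact Finset.sum_congr rfl fun l _ => by ring
  · intro l k
    simp only [Finset.mem_range, Finset.mem_Icc]
    omega

/-! ### Maddox spaces as intersections of weighted spaces -/

theorem rpow_one_div_mul_rpow {p L a : ℝ} (hp : 0 < p) (hL : 0 ≤ L) (ha : 0 ≤ a) :
    (L ^ (1 / p) * a) ^ p = L * a ^ p := by
  rw [Real.mul_rpow (Real.rpow_nonneg hL _) ha, ← Real.rpow_mul hL, one_div_mul_cancel hp.ne',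
    Real.rpow_one]

/-- For bounded `p`, the space `c₀(p)` is the intersection of the weighted spaces of null sequences
with the weights `L ^ (1 / pₖ)`. -/
theorem mem_maddoxC0_iff {p : ℕ → ℝ} (hp : ∀ k, 0 < p k) (hpb : BddAbove (Set.range p))
    {z : ℕ → 𝕜} :
    z ∈ maddoxC0 𝕜 p ↔
      ∀ L : ℕ, 1 ≤ L → Tendsto (fun k => (L : ℝ) ^ (1 / p k) * ‖z k‖) atTop (𝓝 0) := by
  obtain ⟨P, hP⟩ := hpb
  have hP : ∀ k, p k ≤ P := fun k => hP ⟨k, rfl⟩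
  constructor
  · intro hz L hL
    have hL0 : (0 : ℝ) < L := by exact_mod_cast hL
    rw [Metric.tendsto_atTop]
    intro ε hε
    -- With `m ≤ 1`, boundedness of `p` gives `m ^ P ≤ m ^ p k`, so one threshold serves all `k`.
    obtain ⟨m, hm0, hm1, hmε⟩ : ∃ m : ℝ, 0 < m ∧ m ≤ 1 ∧ m ≤ ε :=
      ⟨min ε 1, by positivity, min_le_right _ _, min_le_left _ _⟩
    have hz' : Tendsto (fun k => ‖z k‖ ^ p k) atTop (𝓝 0) := hz
    have hδ : 0 < m ^ P / L := div_pos (Real.rpow_pos_of_pos hm0 _) hL0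
    obtain ⟨K, hK⟩ := Filter.eventually_atTop.1 (hz'.eventually_lt_const hδ)
    refine ⟨K, fun k hk => ?_⟩
    have h0 : 0 ≤ (L : ℝ) ^ (1 / p k) * ‖z k‖ := by positivity
    rw [Real.dist_eq, sub_zero, abs_of_nonneg h0]
    refine lt_of_lt_of_le ?_ hmε
    rw [← Real.rpow_lt_rpow_iff h0 hm0.le (hp k), rpow_one_div_mul_rpow (hp k) hL0.le
      (norm_nonneg _)]
    calc (L : ℝ) * ‖z k‖ ^ p k < L * (m ^ P / L) := mul_lt_mul_of_pos_left (hK k hk) hL0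
      _ = m ^ P := by field_simp
      _ ≤ m ^ p k := Real.rpow_le_rpow_of_exponent_ge hm0 hm1 (hP k)
  · intro h
    change Tendsto (fun k => ‖z k‖ ^ p k) atTop (𝓝 0)
    rw [Metric.tendsto_atTop]
    intro ε hε
    obtain ⟨L, hL⟩ := exists_nat_gt (1 / ε)
    have hL0 : (0 : ℝ) < L := lt_trans (by positivity) hL
    obtain ⟨K, hK⟩ := Filter.eventually_atTop.1
      ((h L (by exact_mod_cast hL0)).eventually_lt_const one_pos)
    refine ⟨K, fun k hk => ?_⟩
    have h0 : 0 ≤ ‖z k‖ ^ p k := by positivity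
    rw [Real.dist_eq, sub_zero, abs_of_nonneg h0]
    have h1 : (L : ℝ) * ‖z k‖ ^ p k < 1 := by
      rw [← rpow_one_div_mul_rpow (hp k) hL0.le (norm_nonneg _)]
      exact Real.rpow_lt_one (by positivity) (hK k hk) (hp k)
    rw [div_lt_iff₀ hε] at hL
    by_contra! hcon
    nlinarith

theorem tendsto_zero_of_mem_maddoxC0 {p : ℕ → ℝ} (hp : ∀ k, 0 < p k)
    (hpb : BddAbove (Set.range p)) {z : ℕ → 𝕜} (hz : z ∈ maddoxC0 𝕜 p) :
    Tendsto z atTop (𝓝 0) := by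
  rw [tendsto_zero_iff_norm_tendsto_zero]
  simpa using (mem_maddoxC0_iff hp hpb).1 hz 1 le_rfl

theorem mem_maddoxC0_of_eventually_eq_zero {p : ℕ → ℝ} (hp : ∀ k, 0 < p k) {z : ℕ → 𝕜}
    (K : ℕ) (hz : ∀ k, K ≤ k → z k = 0) : z ∈ maddoxC0 𝕜 p := by
  refine tendsto_const_nhds.congr' ?_
  filter_upwards [eventually_ge_atTop K] with k hk
  rw [hz k hk, norm_zero, Real.zero_rpow (hp k).ne']

/-! ### Rows with a weighted absolute sum -/

theorem norm_mul_eq_weighted {p : ℕ → ℝ} {N : ℕ} (hN : 1 ≤ N) (b y : ℕ → 𝕜) (k : ℕ) :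
    ‖b k * y k‖ = ‖b k‖ * (N : ℝ) ^ (-(1 / p k)) * ((N : ℝ) ^ (1 / p k) * ‖y k‖) := by
  have hN0 : (0 : ℝ) < N := by exact_mod_cast hN
  have := (Real.rpow_pos_of_pos hN0 (1 / p k)).ne'
  rw [norm_mul, Real.rpow_neg hN0.le]
  field_simp

/-- The indices below `K` are estimated crudely; beyond `K` the weight `N^{-1/pₖ}` on `b` is paired
with `N^{1/pₖ}` on `y`. With `K = 0` this is a plain weighted Hölder bound. -/
theorem sum_norm_mul_le {p : ℕ → ℝ} {N : ℕ} (hN : 1 ≤ N) {b y : ℕ → 𝕜} {C ε : ℝ} (hε : 0 ≤ ε)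
    (hb : ∀ K, ∑ k ∈ Finset.range K, ‖b k‖ * (N : ℝ) ^ (-(1 / p k)) ≤ C) {K : ℕ}
    (hy : ∀ k, K ≤ k → (N : ℝ) ^ (1 / p k) * ‖y k‖ ≤ ε) (m : ℕ) :
    ∑ k ∈ Finset.range m, ‖b k * y k‖ ≤ ∑ k ∈ Finset.range K, ‖b k‖ * ‖y k‖ + C * ε := by
  have h1 : ∀ k, ‖b k * y k‖ ≤ (if k < K then ‖b k‖ * ‖y k‖ else 0)
      + ‖b k‖ * (N : ℝ) ^ (-(1 / p k)) * ε := by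
    intro k
    split_ifs with hk
    · rw [norm_mul]
      exact le_add_of_nonneg_right (by positivity)
    · rw [norm_mul_eq_weighted (p := p) hN, zero_add]
      exact mul_le_mul_of_nonneg_left (hy k (not_lt.1 hk)) (by positivity)
  calc ∑ k ∈ Finset.range m, ‖b k * y k‖
      ≤ ∑ k ∈ Finset.range m, ((if k < K then ‖b k‖ * ‖y k‖ else 0)
          + ‖b k‖ * (N : ℝ) ^ (-(1 / p k)) * ε) := Finset.sum_le_sum fun k _ => h1 k
    _ = ∑ k ∈ (Finset.range m).filter (· < K), ‖b k‖ * ‖y k‖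
          + (∑ k ∈ Finset.range m, ‖b k‖ * (N : ℝ) ^ (-(1 / p k))) * ε := by
        rw [Finset.sum_add_distrib, Finset.sum_filter, Finset.sum_mul]
    _ ≤ _ := by
        refine add_le_add (Finset.sum_le_sum_of_subset_of_nonneg ?_ fun _ _ _ => by positivity)
          (mul_le_mul_of_nonneg_right (hb m) hε)
        intro k hk
        simp only [Finset.mem_filter] at hk
        exact Finset.mem_range.2 hk.2

theorem exists_weight_mul_norm_le {p : ℕ → ℝ} (hp : ∀ k, 0 < p k) (hpb : BddAbove (Set.range p))
    {y : ℕ → 𝕜} (hy : y ∈ maddoxC0 𝕜 p) {N : ℕ} (hN : 1 ≤ N) {ε : ℝ} (hε : 0 < ε) :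
    ∃ K, ∀ k, K ≤ k → (N : ℝ) ^ (1 / p k) * ‖y k‖ ≤ ε :=
  eventually_atTop.1 (((mem_maddoxC0_iff hp hpb).1 hy N hN).eventually_le_const hε)

theorem summable_mul_of_row_le {p : ℕ → ℝ} (hp : ∀ k, 0 < p k) (hpb : BddAbove (Set.range p))
    {y : ℕ → 𝕜} (hy : y ∈ maddoxC0 𝕜 p) {N : ℕ} (hN : 1 ≤ N) {b : ℕ → 𝕜} {C : ℝ}
    (hb : ∀ K, ∑ k ∈ Finset.range K, ‖b k‖ * (N : ℝ) ^ (-(1 / p k)) ≤ C) :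
    Summable fun k => b k * y k := by
  obtain ⟨K, hK⟩ := exists_weight_mul_norm_le hp hpb hy hN one_pos
  exact .of_norm (summable_of_sum_range_le (fun _ => norm_nonneg _)
    (sum_norm_mul_le hN zero_le_one hb hK))

theorem norm_tsum_mul_le {p : ℕ → ℝ} {N : ℕ} (hN : 1 ≤ N) {b y : ℕ → 𝕜} {C ε : ℝ} (hε : 0 ≤ ε)
    (hb : ∀ K, ∑ k ∈ Finset.range K, ‖b k‖ * (N : ℝ) ^ (-(1 / p k)) ≤ C) {K : ℕ}
    (hy : ∀ k, K ≤ k → (N : ℝ) ^ (1 / p k) * ‖y k‖ ≤ ε) :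
    ‖∑' k, b k * y k‖ ≤ ∑ k ∈ Finset.range K, ‖b k‖ * ‖y k‖ + C * ε := by
  have h := sum_norm_mul_le hN hε hb hy
  exact (norm_tsum_le_tsum_norm (summable_of_sum_range_le (fun _ => norm_nonneg _) h)).trans
    (Real.tsum_le_of_sum_range_le (fun _ => norm_nonneg _) h)

/-- A matrix with null columns and bounded weighted rows maps `c₀(p)` into the null sequences. -/
theorem tendsto_tsum_mul_zero {p : ℕ → ℝ} (hp : ∀ k, 0 < p k) (hpb : BddAbove (Set.range p))
    {y : ℕ → 𝕜} (hy : y ∈ maddoxC0 𝕜 p) {N : ℕ} (hN : 1 ≤ N) {b : ℕ → ℕ → 𝕜} {C : ℝ}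
    (hcol : ∀ k, Tendsto (fun n => b n k) atTop (𝓝 0))
    (hb : ∀ n K, ∑ k ∈ Finset.range K, ‖b n k‖ * (N : ℝ) ^ (-(1 / p k)) ≤ C) :
    Tendsto (fun n => ∑' k, b n k * y k) atTop (𝓝 0) := by
  have hC : 0 ≤ C := by simpa using hb 0 0
  rw [Metric.tendsto_atTop]
  intro ε hε
  obtain ⟨K, hK⟩ := exists_weight_mul_norm_le hp hpb hy hN
    (show 0 < ε / (2 * (C + 1)) by positivity)
  have hfin : Tendsto (fun n => ∑ k ∈ Finset.range K, ‖b n k‖ * ‖y k‖) atTop (𝓝 0) := by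
    have := tendsto_finsetSum (Finset.range K) fun k _ => ((hcol k).norm.mul_const ‖y k‖)
    simpa using this
  obtain ⟨n₀, hn₀⟩ := eventually_atTop.1 (hfin.eventually_lt_const (half_pos hε))
  refine ⟨n₀, fun n hn => ?_⟩
  rw [dist_zero_right]
  refine (norm_tsum_mul_le hN (by positivity) (hb n) hK).trans_lt ?_
  have h2 : C * (ε / (2 * (C + 1))) ≤ ε / 2 := by
    rw [mul_div_assoc', div_le_div_iff₀ (by positivity) two_pos]
    nlinarith
  linarith [hn₀ n hn]

/-! ### Uniform boundedness on `c₀(p)` -/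

open scoped ZeroAtInfty

/-- A null sequence as a function vanishing at infinity. -/
def c0OfTendsto (f : ℕ → 𝕜) (hf : Tendsto f atTop (𝓝 0)) : C₀(ℕ, 𝕜) where
  toFun := f
  continuous_toFun := continuous_of_discreteTopology
  zero_at_infty' := by
    rwa [cocompact_eq_cofinite, Nat.cofinite_eq_atTop]

theorem c0_tendsto (f : C₀(ℕ, 𝕜)) : Tendsto f atTop (𝓝 0) := by
  have := f.zero_at_infty'
  rwa [cocompact_eq_cofinite, Nat.cofinite_eq_atTop] at this

theorem c0_norm_apply_le (f : C₀(ℕ, 𝕜)) (k : ℕ) : ‖f k‖ ≤ ‖f‖ := by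
  rw [← ZeroAtInftyContinuousMap.norm_toBCF_eq_norm]
  exact f.toBCF.norm_coe_le_norm k

theorem c0_norm_le (f : C₀(ℕ, 𝕜)) {C : ℝ} (hC : 0 ≤ C) (h : ∀ k, ‖f k‖ ≤ C) : ‖f‖ ≤ C := by
  rw [← ZeroAtInftyContinuousMap.norm_toBCF_eq_norm]
  exact (BoundedContinuousFunction.norm_le hC).2 h

theorem continuous_c0_eval (k : ℕ) : Continuous fun f : C₀(ℕ, 𝕜) => f k :=
  (continuous_eval_const (F := BoundedContinuousFunction ℕ 𝕜) k).comp
    ZeroAtInftyContinuousMap.isometry_toBCF.continuous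

theorem continuous_c0_tsum_mul {c : ℕ → 𝕜} (hc : Summable fun k => ‖c k‖) :
    Continuous fun f : C₀(ℕ, 𝕜) => ∑' k, c k * f k := by
  have hbd : ∀ (f : C₀(ℕ, 𝕜)) k, ‖c k * f k‖ ≤ ‖c k‖ * ‖f‖ := fun f k => by
    rw [norm_mul]
    exact mul_le_mul_of_nonneg_left (c0_norm_apply_le f k) (norm_nonneg _)
  have hs : ∀ f : C₀(ℕ, 𝕜), Summable fun k => c k * f k := fun f =>
    .of_norm_bounded (hc.mul_right _) (hbd f)
  let φ : C₀(ℕ, 𝕜) →ₗ[𝕜] 𝕜 :=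
    { toFun := fun f => ∑' k, c k * f k
      map_add' := fun f g => by
        rw [← (hs f).tsum_add (hs g)]
        exact tsum_congr fun k => by simp [mul_add]
      map_smul' := fun a f => by
        rw [RingHom.id_apply, smul_eq_mul, ← tsum_mul_left]
        exact tsum_congr fun k => by simp [mul_left_comm] }
  exact (φ.mkContinuous (∑' k, ‖c k‖) fun f =>
    tsum_of_norm_bounded (hc.hasSum.mul_right _) (hbd f)).continuous

/-- The space `c₀(p)` as a projective limit of weighted spaces of null sequences. -/
def echelonSpace (𝕜 : Type*) [RCLike 𝕜] (p : ℕ → ℝ) : Submodule 𝕜 (ℕ → C₀(ℕ, 𝕜)) where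
  -- Coordinate `N` carries the weight base `N + 1`, so coordinate `0` is the unweighted sequence.
  carrier := {z | ∀ N k, z N k = (((N + 1 : ℕ) : ℝ) ^ (1 / p k)) • z 0 k}
  add_mem' hx hy N k := by
    simp only [Pi.add_apply, ZeroAtInftyContinuousMap.add_apply, smul_add]
    rw [hx N k, hy N k]
  zero_mem' N k := by simp
  smul_mem' c x hx N k := by
    simp only [Pi.smul_apply, ZeroAtInftyContinuousMap.smul_apply]
    rw [hx N k, smul_comm]

theorem isClosed_echelonSpace (p : ℕ → ℝ) :
    IsClosed (echelonSpace 𝕜 p : Set (ℕ → C₀(ℕ, 𝕜))) := by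
  have : (echelonSpace 𝕜 p : Set (ℕ → C₀(ℕ, 𝕜)))
      = ⋂ N, ⋂ k, {z | z N k = (((N + 1 : ℕ) : ℝ) ^ (1 / p k)) • z 0 k} := by
    ext z
    simp [echelonSpace]
  rw [this]
  exact isClosed_iInter fun N => isClosed_iInter fun k => isClosed_eq
    ((continuous_c0_eval k).comp (continuous_apply N))
    (((continuous_c0_eval k).comp (continuous_apply 0)).const_smul _)

/-- A closed subspace of a countable product of Banach spaces is completely metrizable. -/
instance (p : ℕ → ℝ) : BaireSpace (echelonSpace 𝕜 p) := by
  have := (isClosed_echelonSpace (𝕜 := 𝕜) p).isCompletelyMetrizableSpace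
  exact inferInstanceAs (BaireSpace (echelonSpace 𝕜 p : Set (ℕ → C₀(ℕ, 𝕜))))

theorem apply_zero_mem_maddoxC0 {p : ℕ → ℝ} (hp : ∀ k, 0 < p k) (hpb : BddAbove (Set.range p))
    (z : echelonSpace 𝕜 p) : ⇑(z.1 0) ∈ maddoxC0 𝕜 p := by
  rw [mem_maddoxC0_iff hp hpb]
  intro L hL
  obtain ⟨N, rfl⟩ := Nat.exists_eq_add_of_le' hL
  have h := (c0_tendsto (z.1 N)).norm
  rw [norm_zero] at h
  refine h.congr fun k => ?_
  rw [z.2 N k, norm_smul, Real.norm_of_nonneg (by positivity)]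

/-- A sequence in `c₀(p)` as a point of the projective limit. -/
noncomputable def echelonOf {p : ℕ → ℝ} (hp : ∀ k, 0 < p k) (hpb : BddAbove (Set.range p))
    (y : ℕ → 𝕜) (hy : y ∈ maddoxC0 𝕜 p) : echelonSpace 𝕜 p :=
  ⟨fun N => c0OfTendsto (fun k => (((N + 1 : ℕ) : ℝ) ^ (1 / p k)) • y k) (by
      rw [tendsto_zero_iff_norm_tendsto_zero]
      refine ((mem_maddoxC0_iff hp hpb).1 hy (N + 1) (by omega)).congr fun k => ?_
      rw [norm_smul, Real.norm_of_nonneg (by positivity)]), fun N k => by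
    change _ = (((N + 1 : ℕ) : ℝ) ^ (1 / p k)) • ((((0 + 1 : ℕ) : ℝ) ^ (1 / p k)) • y k)
    simp only [zero_add, Nat.cast_one, Real.one_rpow, one_smul]
    rfl⟩

theorem echelonOf_apply {p : ℕ → ℝ} (hp : ∀ k, 0 < p k) (hpb : BddAbove (Set.range p))
    (y : ℕ → 𝕜) (hy : y ∈ maddoxC0 𝕜 p) (N k : ℕ) :
    (echelonOf hp hpb y hy).1 N k = (((N + 1 : ℕ) : ℝ) ^ (1 / p k)) • y k := rfl

theorem echelonOf_apply_zero {p : ℕ → ℝ} (hp : ∀ k, 0 < p k) (hpb : BddAbove (Set.range p))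
    (y : ℕ → 𝕜) (hy : y ∈ maddoxC0 𝕜 p) (k : ℕ) : (echelonOf hp hpb y hy).1 0 k = y k := by
  rw [echelonOf_apply]
  simp

/-- In coordinate `M` the norm is at most the supremum over `k` of `((M+1)/(N+1))^{1/pₖ}`. For `N ≥
M` the base is at most `1`, so the bound `P` of `p` makes this decay uniform in `k`. -/
theorem tendsto_echelonOf_zero {p : ℕ → ℝ} (hp : ∀ k, 0 < p k) (hpb : BddAbove (Set.range p))
    (v : ℕ → ℕ → 𝕜) (hv : ∀ N, v N ∈ maddoxC0 𝕜 p)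
    (hle : ∀ N k, ‖v N k‖ ≤ ((N + 1 : ℕ) : ℝ) ^ (-(1 / p k))) :
    Tendsto (fun N => echelonOf hp hpb (v N) (hv N)) atTop (𝓝 0) := by
  obtain ⟨P, hP⟩ := id hpb
  have hP : ∀ k, p k ≤ P := fun k => hP ⟨k, rfl⟩
  have hP0 : 0 < P := (hp 0).trans_le (hP 0)
  rw [tendsto_subtype_rng, tendsto_pi_nhds]
  intro M
  change Tendsto _ _ (𝓝 0)
  have hlim : Tendsto (fun N : ℕ => (((M + 1 : ℕ) : ℝ) / ((N + 1 : ℕ) : ℝ)) ^ (1 / P)) atTop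
      (𝓝 0) := by
    have h1 : Tendsto (fun N : ℕ => ((M + 1 : ℕ) : ℝ) / ((N + 1 : ℕ) : ℝ)) atTop (𝓝 0) :=
      (tendsto_const_div_atTop_nhds_zero_nat _).comp (tendsto_add_atTop_nat 1)
    have h2 := h1.rpow_const (p := 1 / P) (Or.inr (by positivity))
    rwa [Real.zero_rpow (by positivity)] at h2
  refine squeeze_zero_norm' ?_ hlim
  filter_upwards [eventually_ge_atTop M] with N hN
  refine c0_norm_le _ (by positivity) fun k => ?_
  rw [echelonOf_apply, norm_smul, Real.norm_of_nonneg (by positivity)]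
  have hN0 : (0 : ℝ) < ((N + 1 : ℕ) : ℝ) := by positivity
  calc ((M + 1 : ℕ) : ℝ) ^ (1 / p k) * ‖v N k‖
      ≤ ((M + 1 : ℕ) : ℝ) ^ (1 / p k) * ((N + 1 : ℕ) : ℝ) ^ (-(1 / p k)) :=
        mul_le_mul_of_nonneg_left (hle N k) (by positivity)
    _ = (((M + 1 : ℕ) : ℝ) / ((N + 1 : ℕ) : ℝ)) ^ (1 / p k) := by
        rw [Real.div_rpow (by positivity) hN0.le, Real.rpow_neg hN0.le]
        exact (div_eq_mul_inv _ _).symm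
    _ ≤ _ := by
        refine Real.rpow_le_rpow_of_exponent_ge (by positivity) ?_
          (one_div_le_one_div_of_le (hp k) (hP k))
        rw [div_le_one hN0]
        exact_mod_cast Nat.succ_le_succ hN

theorem exists_unit_mul_eq_norm (b : 𝕜) : ∃ u : 𝕜, ‖u‖ ≤ 1 ∧ b * u = (‖b‖ : 𝕜) := by
  rcases eq_or_ne b 0 with rfl | hb
  · exact ⟨0, by simp, by simp⟩
  · have hb' : (‖b‖ : 𝕜) ≠ 0 := by simpa using hb
    refine ⟨(starRingEnd 𝕜) b / (‖b‖ : 𝕜), ?_, ?_⟩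
    · rw [norm_div, RCLike.norm_conj]
      simp [hb]
    · rw [← mul_div_assoc, RCLike.mul_conj, sq, mul_div_assoc, div_self hb', mul_one]

/-- Uniform boundedness principle on `c₀(p)`: if every `y` is bounded along the rows of `b` by one
of countably many bounds `c L`, then one of these bounds holds, up to a factor `2`, for some
weighted absolute row sums. -/
theorem exists_forall_row_le {p : ℕ → ℝ} (hp : ∀ k, 0 < p k) (hpb : BddAbove (Set.range p))
    (b : ℕ → ℕ → 𝕜)
    (hb : ∀ n, ∃ N : ℕ, 1 ≤ N ∧ ∃ C, ∀ K,
      ∑ k ∈ Finset.range K, ‖b n k‖ * (N : ℝ) ^ (-(1 / p k)) ≤ C)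
    (c : ℕ → ℕ → ℝ) (h : ∀ y ∈ maddoxC0 𝕜 p, ∃ L, ∀ n, ‖∑' k, b n k * y k‖ ≤ c L n) :
    ∃ L N : ℕ, 1 ≤ N ∧ ∀ n K,
      ∑ k ∈ Finset.range K, ‖b n k‖ * (N : ℝ) ^ (-(1 / p k)) ≤ 2 * c L n := by
  -- Each row functional factors through a coordinate whose weight makes the coefficients absolutely
  -- summable.
  have hcont : ∀ n, Continuous fun z : echelonSpace 𝕜 p => ∑' k, b n k * z.1 0 k := by
    intro n
    obtain ⟨N, hN, C, hC⟩ := hb n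
    obtain ⟨N, rfl⟩ := Nat.exists_eq_add_of_le' hN
    have hc : Summable fun k => ‖(((N + 1 : ℕ) : ℝ) ^ (-(1 / p k))) • b n k‖ := by
      refine summable_of_sum_range_le (c := C) (fun _ => norm_nonneg _) fun K => ?_
      convert hC K using 2 with k
      rw [norm_smul, Real.norm_of_nonneg (by positivity), mul_comm]
    have hN : Continuous fun z : echelonSpace 𝕜 p => z.1 N :=
      (continuous_apply N).comp continuous_subtype_val
    convert (continuous_c0_tsum_mul hc).comp hN
      using 2 with z
    refine tsum_congr fun k => ?_
    have hN0 : (0 : ℝ) < ((N + 1 : ℕ) : ℝ) := by positivity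
    rw [z.2 N k, smul_mul_smul_comm, ← Real.rpow_add hN0, neg_add_cancel, Real.rpow_zero, one_smul]
  let F : ℕ → Set (echelonSpace 𝕜 p) := fun L => {z | ∀ n, ‖∑' k, b n k * z.1 0 k‖ ≤ c L n}
  have hF : ∀ L, IsClosed (F L) := fun L => by
    have : F L = ⋂ n, {z | ‖∑' k, b n k * z.1 0 k‖ ≤ c L n} := by ext; simp [F]
    rw [this]
    exact isClosed_iInter fun n => isClosed_le (hcont n).norm continuous_const
  have hU : ⋃ L, F L = Set.univ := Set.eq_univ_of_forall fun z =>
    Set.mem_iUnion.2 (h _ (apply_zero_mem_maddoxC0 hp hpb z))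
  obtain ⟨L, z₀, hz₀⟩ := nonempty_interior_of_iUnion_of_closed hF hU
  refine ⟨L, ?_⟩
  by_contra! hcon
  have hcon' : ∀ N : ℕ, ∃ n K, 2 * c L n <
      ∑ k ∈ Finset.range K, ‖b n k‖ * ((N + 1 : ℕ) : ℝ) ^ (-(1 / p k)) :=
    fun N => hcon (N + 1) (by omega)
  choose n K hnK using hcon'
  choose u hu1 hu2 using exists_unit_mul_eq_norm (𝕜 := 𝕜)
  -- A finitely supported perturbation with phases aligned to the offending row: applying that row
  -- yields exactly its weighted partial sum, while the perturbations tend to zero.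
  let v : ℕ → ℕ → 𝕜 := fun N k =>
    if k < K N then (((N + 1 : ℕ) : ℝ) ^ (-(1 / p k))) • u (b (n N) k) else 0
  have hv : ∀ N, v N ∈ maddoxC0 𝕜 p := fun N =>
    mem_maddoxC0_of_eventually_eq_zero hp (K N) fun k hk => if_neg hk.not_gt
  have hvle : ∀ N k, ‖v N k‖ ≤ ((N + 1 : ℕ) : ℝ) ^ (-(1 / p k)) := by
    intro N k
    simp only [v]
    split_ifs with hk
    · rw [norm_smul, Real.norm_of_nonneg (by positivity)]
      exact mul_le_of_le_one_right (by positivity) (hu1 _)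
    · rw [norm_zero]
      positivity
  have hlim : Tendsto (fun N => z₀ + echelonOf hp hpb (v N) (hv N)) atTop (𝓝 z₀) := by
    have := (tendsto_subtype_rng.1 (tendsto_echelonOf_zero hp hpb v hv hvle)).const_add z₀.1
    rw [tendsto_subtype_rng]
    simpa using this
  -- Both `z₀` and its perturbation lie in `F L`; subtracting them costs the factor `2`.
  obtain ⟨N, hN⟩ := (hlim.eventually (mem_interior_iff_mem_nhds.1 hz₀)).exists
  have h1 := hN (n N)
  have h2 := interior_subset hz₀ (n N)
  obtain ⟨N', hN', C, hC⟩ := hb (n N)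
  have hsum : Summable fun k => b (n N) k * z₀.1 0 k :=
    summable_mul_of_row_le hp hpb (apply_zero_mem_maddoxC0 hp hpb z₀) hN' hC
  have hsum' : Summable fun k => b (n N) k * v N k :=
    summable_mul_of_row_le hp hpb (hv N) hN' hC
  have h3 : ∑' k, b (n N) k * (z₀ + echelonOf hp hpb (v N) (hv N)).1 0 k
      = ∑' k, b (n N) k * z₀.1 0 k + ∑' k, b (n N) k * v N k := by
    rw [← hsum.tsum_add hsum']
    refine tsum_congr fun k => ?_
    rw [← mul_add, ← echelonOf_apply_zero hp hpb (v N) (hv N) k]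
    rfl
  have h4 : ∑' k, b (n N) k * v N k =
      ((∑ k ∈ Finset.range (K N), ‖b (n N) k‖ * ((N + 1 : ℕ) : ℝ) ^ (-(1 / p k)) : ℝ) : 𝕜) := by
    rw [tsum_eq_sum (s := Finset.range (K N)), RCLike.ofReal_sum]
    · refine Finset.sum_congr rfl fun k hk => ?_
      simp only [v]
      rw [if_pos (Finset.mem_range.1 hk), mul_smul_comm, hu2, RCLike.real_smul_eq_coe_mul,
        RCLike.ofReal_mul, mul_comm]
    · intro k hk
      simp only [v]
      rw [if_neg (by simpa using hk), mul_zero]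
  rw [h3] at h1
  have h5 : ‖∑' k, b (n N) k * v N k‖ ≤ 2 * c L (n N) := by
    have := norm_sub_le (∑' k, b (n N) k * z₀.1 0 k + ∑' k, b (n N) k * v N k)
      (∑' k, b (n N) k * z₀.1 0 k)
    rw [add_sub_cancel_left] at this
    linarith
  rw [h4, RCLike.norm_ofReal] at h5
  exact absurd ((le_abs_self _).trans h5) (hnK N).not_ge

/-! ### Limits of rows and the β-dual -/

theorem sum_weighted_norm_sub_le {p : ℕ → ℝ} {N : ℕ} {b α : ℕ → 𝕜} {C D : ℝ}
    (hb : ∀ K, ∑ k ∈ Finset.range K, ‖b k‖ * (N : ℝ) ^ (-(1 / p k)) ≤ C)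
    (hα : ∀ K, ∑ k ∈ Finset.range K, ‖α k‖ * (N : ℝ) ^ (-(1 / p k)) ≤ D) (K : ℕ) :
    ∑ k ∈ Finset.range K, ‖b k - α k‖ * (N : ℝ) ^ (-(1 / p k)) ≤ C + D := by
  refine le_trans (Finset.sum_le_sum fun k _ => ?_)
    (Finset.sum_add_distrib.trans_le (add_le_add (hb K) (hα K)))
  rw [← add_mul]
  exact mul_le_mul_of_nonneg_right (norm_sub_le _ _) (by positivity)

theorem sum_weighted_norm_le_of_tendsto {p : ℕ → ℝ} {N : ℕ} {b : ℕ → ℕ → 𝕜} {α : ℕ → 𝕜} {C : ℝ}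
    (hcol : ∀ k, Tendsto (fun n => b n k) atTop (𝓝 (α k)))
    (hb : ∀ n K, ∑ k ∈ Finset.range K, ‖b n k‖ * (N : ℝ) ^ (-(1 / p k)) ≤ C) (K : ℕ) :
    ∑ k ∈ Finset.range K, ‖α k‖ * (N : ℝ) ^ (-(1 / p k)) ≤ C :=
  le_of_tendsto (tendsto_finsetSum (Finset.range K) fun k _ =>
    ((hcol k).norm.mul_const ((N : ℝ) ^ (-(1 / p k))))) (Eventually.of_forall fun n => hb n K)

/-- The limit row `α` inherits the bound `C`, so the null-column case applies to `b - α`. -/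
theorem tendsto_tsum_mul {p : ℕ → ℝ} (hp : ∀ k, 0 < p k) (hpb : BddAbove (Set.range p))
    {y : ℕ → 𝕜} (hy : y ∈ maddoxC0 𝕜 p) {N : ℕ} (hN : 1 ≤ N) {b : ℕ → ℕ → 𝕜} {α : ℕ → 𝕜} {C : ℝ}
    (hcol : ∀ k, Tendsto (fun n => b n k) atTop (𝓝 (α k)))
    (hb : ∀ n K, ∑ k ∈ Finset.range K, ‖b n k‖ * (N : ℝ) ^ (-(1 / p k)) ≤ C) :
    Tendsto (fun n => ∑' k, b n k * y k) atTop (𝓝 (∑' k, α k * y k)) := by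
  have hα := sum_weighted_norm_le_of_tendsto hcol hb
  have h0 := tendsto_tsum_mul_zero hp hpb hy hN (b := fun n k => b n k - α k)
    (fun k => by simpa using (hcol k).sub_const (α k))
    (fun n => sum_weighted_norm_sub_le (hb n) hα)
  have h1 := h0.add_const (∑' k, α k * y k)
  rw [zero_add] at h1
  refine h1.congr fun n => ?_
  rw [← Summable.tsum_add]
  · exact tsum_congr fun k => by ring
  · exact summable_mul_of_row_le hp hpb hy hN (sum_weighted_norm_sub_le (hb n) hα)
  · exact summable_mul_of_row_le hp hpb hy hN hα

theorem single_mem_maddoxC0 {p : ℕ → ℝ} (hp : ∀ k, 0 < p k) (k : ℕ) :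
    (Pi.single k 1 : ℕ → 𝕜) ∈ maddoxC0 𝕜 p :=
  mem_maddoxC0_of_eventually_eq_zero hp (k + 1) fun j hj => by
    rw [Pi.single_eq_of_ne (by omega)]

theorem tsum_mul_single (b : ℕ → 𝕜) (k : ℕ) :
    ∑' j, b j * (Pi.single k 1 : ℕ → 𝕜) j = b k := by
  rw [tsum_eq_single k fun j hj => by rw [Pi.single_eq_of_ne hj, mul_zero], Pi.single_eq_same,
    mul_one]

theorem exists_nat_norm_le_of_tendsto {E : Type*} [SeminormedAddCommGroup E] {z : ℕ → E} {l : E}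
    (h : Tendsto z atTop (𝓝 l)) : ∃ L : ℕ, ∀ n, ‖z n‖ ≤ L := by
  obtain ⟨C, hC⟩ := h.norm.bddAbove_range
  obtain ⟨L, hL⟩ := exists_nat_ge C
  exact ⟨L, fun n => (hC ⟨n, rfl⟩).trans hL⟩

/-- A matrix whose rows are weighted absolutely summable and that maps `c₀(p)` into the convergent
sequences has uniformly bounded weighted row sums. -/
theorem exists_row_le_of_tendsto {p : ℕ → ℝ} (hp : ∀ k, 0 < p k) (hpb : BddAbove (Set.range p))
    (b : ℕ → ℕ → 𝕜)
    (hb : ∀ n, ∃ N : ℕ, 1 ≤ N ∧ ∃ C, ∀ K,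
      ∑ k ∈ Finset.range K, ‖b n k‖ * (N : ℝ) ^ (-(1 / p k)) ≤ C)
    (h : ∀ y ∈ maddoxC0 𝕜 p, ∃ l, Tendsto (fun n => ∑' k, b n k * y k) atTop (𝓝 l)) :
    ∃ N : ℕ, 1 ≤ N ∧ ∃ C, ∀ n K,
      ∑ k ∈ Finset.range K, ‖b n k‖ * (N : ℝ) ^ (-(1 / p k)) ≤ C := by
  obtain ⟨L, N, hN, hle⟩ := exists_forall_row_le hp hpb b hb (fun L _ => (L : ℝ)) fun y hy => by
    obtain ⟨l, hl⟩ := h y hy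
    exact exists_nat_norm_le_of_tendsto hl
  exact ⟨N, hN, 2 * L, hle⟩

theorem Emat_eq_zero (r s t a : ℕ → 𝕜) {m k : ℕ} (hk : k ∉ Finset.range (m + 1)) :
    Emat r s t a m k = 0 :=
  if_neg (by simpa [Nat.lt_succ_iff] using hk)

theorem sum_mul_eq_tsum_Emat_mul (r s t : ℕ → 𝕜) (hr : ∀ n, r n ≠ 0) (hs : s 0 ≠ 0)
    (ht : ∀ n, t n ≠ 0) (a x : ℕ → 𝕜) (m : ℕ) :
    ∑ k ∈ Finset.range (m + 1), a k * x k =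
      ∑' k, Emat r s t a m k * genMean r s t (diff x) k := by
  rw [sum_mul_eq_sum_Emat_mul r s t hr hs ht, tsum_eq_sum fun k hk => by
    rw [Emat_eq_zero r s t a hk, zero_mul]]

theorem exists_tendsto_tsum_Emat_mul (r s t : ℕ → 𝕜) (hr : ∀ n, r n ≠ 0) (hs : s 0 ≠ 0)
    (ht : ∀ n, t n ≠ 0) {X : Set (ℕ → 𝕜)} {a : ℕ → 𝕜} (ha : a ∈ betaDual (meanDiffSpace r s t X))
    {y : ℕ → 𝕜} (hy : y ∈ X) :
    ∃ l, Tendsto (fun m => ∑' k, Emat r s t a m k * y k) atTop (𝓝 l) := by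
  obtain ⟨x, rfl⟩ := exists_genMean_diff_eq r s t hr hs ht y
  obtain ⟨l, hl⟩ := ha x hy
  exact ⟨l, (hl.comp (tendsto_add_atTop_nat 1)).congr
    (sum_mul_eq_tsum_Emat_mul r s t hr hs ht a x)⟩

/-- The limits defining `Ẽ` exist for rows in the β-dual. -/
theorem tendsto_Emat (r s t : ℕ → 𝕜) (hr : ∀ n, r n ≠ 0) (hs : s 0 ≠ 0) (ht : ∀ n, t n ≠ 0)
    {p : ℕ → ℝ} (hp : ∀ k, 0 < p k) {a : ℕ → 𝕜}
    (ha : a ∈ betaDual (meanDiffSpace r s t (maddoxC0 𝕜 p))) (k : ℕ) :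
    Tendsto (fun m => Emat r s t a m k) atTop
      (𝓝 (limUnder atTop fun m => Emat r s t a m k)) := by
  obtain ⟨l, hl⟩ := exists_tendsto_tsum_Emat_mul r s t hr hs ht ha (single_mem_maddoxC0 hp k)
  simp only [tsum_mul_single] at hl
  exact tendsto_nhds_limUnder ⟨l, hl⟩

theorem exists_row_le_Emat (r s t : ℕ → 𝕜) (hr : ∀ n, r n ≠ 0) (hs : s 0 ≠ 0)
    (ht : ∀ n, t n ≠ 0) {p : ℕ → ℝ} (hp : ∀ k, 0 < p k) (hpb : BddAbove (Set.range p))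
    {a : ℕ → 𝕜} (ha : a ∈ betaDual (meanDiffSpace r s t (maddoxC0 𝕜 p))) :
    ∃ N : ℕ, 1 ≤ N ∧ ∃ C, ∀ m K,
      ∑ k ∈ Finset.range K, ‖Emat r s t a m k‖ * (N : ℝ) ^ (-(1 / p k)) ≤ C := by
  refine exists_row_le_of_tendsto hp hpb (Emat r s t a) (fun m => ?_)
    fun y hy => exists_tendsto_tsum_Emat_mul r s t hr hs ht ha hy
  -- Rows of a triangle are finite, so any weight works.
  refine ⟨1, le_rfl, ∑' k, ‖Emat r s t a m k‖ * ((1 : ℕ) : ℝ) ^ (-(1 / p k)), fun K => ?_⟩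
  refine Summable.sum_le_tsum _ (fun k _ => by positivity)
    (summable_of_ne_finset_zero (s := Finset.range (m + 1)) fun k hk => ?_)
  rw [Emat_eq_zero r s t a hk, norm_zero, zero_mul]

theorem betaDual_spec (r s t : ℕ → 𝕜) (hr : ∀ n, r n ≠ 0) (hs : s 0 ≠ 0) (ht : ∀ n, t n ≠ 0)
    {p : ℕ → ℝ} (hp : ∀ k, 0 < p k) (hpb : BddAbove (Set.range p)) {a e : ℕ → 𝕜}
    (ha : a ∈ betaDual (meanDiffSpace r s t (maddoxC0 𝕜 p)))
    (he : ∀ k, Tendsto (fun m => Emat r s t a m k) atTop (𝓝 (e k))) :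
    (∃ N : ℕ, 1 ≤ N ∧ ∃ C, ∀ K,
      ∑ k ∈ Finset.range K, ‖e k‖ * (N : ℝ) ^ (-(1 / p k)) ≤ C) ∧
      ∀ x ∈ meanDiffSpace r s t (maddoxC0 𝕜 p),
        Tendsto (fun m => ∑ k ∈ Finset.range m, a k * x k) atTop
          (𝓝 (∑' k, e k * genMean r s t (diff x) k)) := by
  obtain ⟨N, hN, C, hC⟩ := exists_row_le_Emat r s t hr hs ht hp hpb ha
  refine ⟨⟨N, hN, C, sum_weighted_norm_le_of_tendsto he hC⟩, fun x hx => ?_⟩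
  have hy : genMean r s t (diff x) ∈ maddoxC0 𝕜 p := hx
  have h := tendsto_tsum_mul hp hpb hy hN he hC
  simp only [← sum_mul_eq_tsum_Emat_mul r s t hr hs ht a x] at h
  exact (tendsto_add_atTop_iff_nat (f := fun m => ∑ k ∈ Finset.range m, a k * x k) 1).1 h

/-- If the rows of `A` lie in the β-dual, then `A` acts on `X(r, s, t; Δ)` as `Ẽ` acts on `X`. -/
theorem mem_matrixClass_iff (r s t : ℕ → 𝕜) (hr : ∀ n, r n ≠ 0) (hs : s 0 ≠ 0)
    (ht : ∀ n, t n ≠ 0) {p : ℕ → ℝ} (hp : ∀ k, 0 < p k) (hpb : BddAbove (Set.range p))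
    {A : ℕ → ℕ → 𝕜} (hA : ∀ n, A n ∈ betaDual (meanDiffSpace r s t (maddoxC0 𝕜 p)))
    (V : Set (ℕ → 𝕜)) :
    A ∈ matrixClass (meanDiffSpace r s t (maddoxC0 𝕜 p)) V ↔
      ∀ y ∈ maddoxC0 𝕜 p, (fun n => ∑' k, Etilde r s t A n k * y k) ∈ V := by
  have hT : ∀ x ∈ meanDiffSpace r s t (maddoxC0 𝕜 p),
      IsTransform A x fun n => ∑' k, Etilde r s t A n k * genMean r s t (diff x) k :=
    fun x hx n => (betaDual_spec r s t hr hs ht hp hpb (hA n)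
      (tendsto_Emat r s t hr hs ht hp (hA n))).2 x hx
  constructor
  · intro h y hy
    obtain ⟨x, rfl⟩ := exists_genMean_diff_eq r s t hr hs ht y
    obtain ⟨z, hz, hzt⟩ := h x hy
    have : z = fun n => ∑' k, Etilde r s t A n k * genMean r s t (diff x) k :=
      funext fun n => tendsto_nhds_unique (hzt n) (hT x hy n)
    rwa [← this]
  · exact fun h x hx => ⟨_, h _ hx, hT x hx⟩

theorem mem_betaDual_of_mem_matrixClass {U V : Set (ℕ → 𝕜)} {A : ℕ → ℕ → 𝕜}
    (hA : A ∈ matrixClass U V) (n : ℕ) : A n ∈ betaDual U := fun x hx => by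
  obtain ⟨z, -, hz⟩ := hA x hx
  exact ⟨z n, hz n⟩

/-! ### The summability conditions in terms of real partial sums -/

theorem tsum_ofReal_le_iff {f : ℕ → ℝ} (hf : ∀ k, 0 ≤ f k) {C : ℝ} (hC : 0 ≤ C) :
    ∑' k, ENNReal.ofReal (f k) ≤ ENNReal.ofReal C ↔ ∀ K, ∑ k ∈ Finset.range K, f k ≤ C := by
  rw [ENNReal.tsum_eq_iSup_nat, iSup_le_iff]
  refine forall_congr' fun K => ?_
  rw [← ENNReal.ofReal_sum_of_nonneg fun k _ => hf k, ENNReal.ofReal_le_ofReal_iff hC]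

theorem iSup_tsum_ofReal_lt_top_iff {f : ℕ → ℕ → ℝ} (hf : ∀ n k, 0 ≤ f n k) :
    (⨆ n, ∑' k, ENNReal.ofReal (f n k)) < ⊤ ↔
      ∃ C, ∀ n K, ∑ k ∈ Finset.range K, f n k ≤ C := by
  constructor
  · intro h
    refine ⟨(⨆ n, ∑' k, ENNReal.ofReal (f n k)).toReal, fun n =>
      (tsum_ofReal_le_iff (hf n) ENNReal.toReal_nonneg).1 ?_⟩
    rw [ENNReal.ofReal_toReal h.ne]
    exact le_iSup (fun n => ∑' k, ENNReal.ofReal (f n k)) n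
  · rintro ⟨C, hC⟩
    have hC0 : 0 ≤ C := by simpa using hC 0 0
    exact (iSup_le fun n => (tsum_ofReal_le_iff (hf n) hC0).2 (hC n)).trans_lt
      ENNReal.ofReal_lt_top

theorem natCast_rpow_eq_ofReal {N : ℕ} (hN : 1 ≤ N) (e : ℝ) :
    (N : ℝ≥0∞) ^ e = ENNReal.ofReal ((N : ℝ) ^ e) := by
  rw [← ENNReal.ofReal_rpow_of_pos (by exact_mod_cast hN), ENNReal.ofReal_natCast]

theorem enorm_mul_rpow_eq_ofReal {N : ℕ} (hN : 1 ≤ N) (b : 𝕜) (e : ℝ) :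
    ‖b‖ₑ * (N : ℝ≥0∞) ^ e = ENNReal.ofReal (‖b‖ * (N : ℝ) ^ e) := by
  rw [natCast_rpow_eq_ofReal hN, ENNReal.ofReal_mul (norm_nonneg _), ofReal_norm]

theorem condRowBdd_iff {p : ℕ → ℝ} {A : ℕ → ℕ → 𝕜} :
    CondRowBdd p A ↔ ∃ N : ℕ, 1 ≤ N ∧ ∃ C, ∀ n K,
      ∑ k ∈ Finset.range K, ‖A n k‖ * (N : ℝ) ^ (-(1 / p k)) ≤ C := by
  refine exists_congr fun N => and_congr_right fun hN => ?_
  simp only [enorm_mul_rpow_eq_ofReal hN]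
  exact iSup_tsum_ofReal_lt_top_iff fun n k => by positivity

theorem condRowNull_iff {p q : ℕ → ℝ} {A : ℕ → ℕ → 𝕜} :
    CondRowNull p q A ↔ ∀ L : ℕ, 1 ≤ L → ∃ N : ℕ, 1 ≤ N ∧ ∃ C, ∀ n K,
      (L : ℝ) ^ (1 / q n) * ∑ k ∈ Finset.range K, ‖A n k‖ * (N : ℝ) ^ (-(1 / p k)) ≤ C := by
  refine forall_congr' fun L => forall_congr' fun hL =>
    exists_congr fun N => and_congr_right fun hN => ?_
  have h0 : ∀ n, 0 ≤ (L : ℝ) ^ (1 / q n) := fun n => by positivity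
  simp only [enorm_mul_rpow_eq_ofReal hN, natCast_rpow_eq_ofReal hL, ← ENNReal.tsum_mul_left,
    ← ENNReal.ofReal_mul (h0 _), Finset.mul_sum]
  exact iSup_tsum_ofReal_lt_top_iff fun n k => by positivity

theorem condRowPowBdd_iff {p q : ℕ → ℝ} (hq : ∀ n, 0 < q n) {A : ℕ → ℕ → 𝕜} :
    CondRowPowBdd p q A ↔ ∃ N : ℕ, 1 ≤ N ∧ ∃ C : ℕ, 1 ≤ C ∧ ∀ n K,
      ∑ k ∈ Finset.range K, ‖A n k‖ * (N : ℝ) ^ (-(1 / p k)) ≤ (C : ℝ) ^ (1 / q n) := by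
  refine exists_congr fun N => and_congr_right fun hN => ?_
  have key : ∀ C : ℕ, 1 ≤ C →
      ((⨆ n, (∑' k, ‖A n k‖ₑ * (N : ℝ≥0∞) ^ (-(1 / p k))) ^ q n) ≤ (C : ℝ≥0∞) ↔ ∀ n K,
        ∑ k ∈ Finset.range K, ‖A n k‖ * (N : ℝ) ^ (-(1 / p k)) ≤ (C : ℝ) ^ (1 / q n)) := by
    intro C hC
    rw [iSup_le_iff]
    refine forall_congr' fun n => ?_
    rw [← tsum_ofReal_le_iff (fun k => by positivity) (by positivity),
      ← natCast_rpow_eq_ofReal hC, one_div (q n), ENNReal.le_rpow_inv_iff (hq n)]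
    simp only [enorm_mul_rpow_eq_ofReal hN]
  constructor
  · intro h
    obtain ⟨C, hC⟩ := ENNReal.exists_nat_gt h.ne
    refine ⟨C + 1, by omega, (key _ (by omega)).1 (hC.le.trans ?_)⟩
    exact_mod_cast Nat.le_succ C
  · rintro ⟨C, hC1, hC⟩
    exact ((key C hC1).2 hC).trans_lt (ENNReal.natCast_lt_top C)

/-! ### Matrix transformations on `c₀(p)` -/

/-- Membership in `c₀(q)` is tested by the factors `L^{1/qₙ}`. For fixed `L`, necessity is uniform
boundedness with the bounds `M / L^{1/qₙ}`, and sufficiency is the null-sequence result for the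
rescaled matrix. -/
theorem forall_mem_maddoxC0_iff {p q : ℕ → ℝ} (hp : ∀ k, 0 < p k)
    (hpb : BddAbove (Set.range p)) (hq : ∀ k, 0 < q k) (hqb : BddAbove (Set.range q))
    (b : ℕ → ℕ → 𝕜)
    (hb : ∀ n, ∃ N : ℕ, 1 ≤ N ∧ ∃ C, ∀ K,
      ∑ k ∈ Finset.range K, ‖b n k‖ * (N : ℝ) ^ (-(1 / p k)) ≤ C) :
    (∀ y ∈ maddoxC0 𝕜 p, (fun n => ∑' k, b n k * y k) ∈ maddoxC0 𝕜 q) ↔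
      CondColNull q b ∧ CondRowNull p q b := by
  rw [condRowNull_iff]
  constructor
  · intro h
    refine ⟨fun k => ?_, fun L hL => ?_⟩
    · have := h _ (single_mem_maddoxC0 hp k)
      simp only [tsum_mul_single] at this
      exact this
    · have hL0 : ∀ n, 0 < (L : ℝ) ^ (1 / q n) := fun n =>
        Real.rpow_pos_of_pos (by exact_mod_cast hL) _
      obtain ⟨M, N, hN, hle⟩ := exists_forall_row_le hp hpb b hb
        (fun M n => M / (L : ℝ) ^ (1 / q n)) fun y hy => by
          obtain ⟨M, hM⟩ := exists_nat_norm_le_of_tendsto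
            ((mem_maddoxC0_iff hq hqb).1 (h y hy) L hL)
          refine ⟨M, fun n => ?_⟩
          rw [le_div_iff₀' (hL0 n)]
          exact (le_abs_self _).trans (hM n)
      refine ⟨N, hN, 2 * M, fun n K => ?_⟩
      rw [← le_div_iff₀' (hL0 n), mul_div_assoc]
      exact hle n K
  · rintro ⟨hcol, hrow⟩ y hy
    rw [mem_maddoxC0_iff hq hqb]
    intro L hL
    obtain ⟨N, hN, C, hC⟩ := hrow L hL
    have hL0 : ∀ n, 0 ≤ (L : ℝ) ^ (1 / q n) := fun n => by positivity
    have h := tendsto_tsum_mul_zero hp hpb hy hN (C := C)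
      (b := fun n k => ((L : ℝ) ^ (1 / q n)) • b n k) (fun k => by
        rw [tendsto_zero_iff_norm_tendsto_zero]
        refine ((mem_maddoxC0_iff hq hqb).1 (hcol k) L hL).congr fun n => ?_
        rw [norm_smul, Real.norm_of_nonneg (hL0 n)]) (fun n K => by
        refine le_of_eq_of_le ?_ (hC n K)
        rw [Finset.mul_sum]
        refine Finset.sum_congr rfl fun k _ => ?_
        rw [norm_smul, Real.norm_of_nonneg (hL0 n), mul_assoc])
    rw [tendsto_zero_iff_norm_tendsto_zero] at h
    refine h.congr fun n => ?_
    simp only [RCLike.real_smul_eq_coe_mul, mul_assoc]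
    rw [tsum_mul_left, norm_mul, RCLike.norm_ofReal, abs_of_nonneg (hL0 n)]

theorem forall_mem_maddoxLinf_iff {p q : ℕ → ℝ} (hp : ∀ k, 0 < p k)
    (hpb : BddAbove (Set.range p)) (hq : ∀ k, 0 < q k) (hqb : BddAbove (Set.range q))
    (b : ℕ → ℕ → 𝕜)
    (hb : ∀ n, ∃ N : ℕ, 1 ≤ N ∧ ∃ C, ∀ K,
      ∑ k ∈ Finset.range K, ‖b n k‖ * (N : ℝ) ^ (-(1 / p k)) ≤ C) :
    (∀ y ∈ maddoxC0 𝕜 p, (fun n => ∑' k, b n k * y k) ∈ maddoxLinf 𝕜 q) ↔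
      CondRowPowBdd p q b := by
  rw [condRowPowBdd_iff hq]
  obtain ⟨Q, hQ⟩ : ∃ Q : ℕ, ∀ n, q n ≤ Q := by
    obtain ⟨Q, hQ⟩ := hqb
    obtain ⟨Q', hQ'⟩ := exists_nat_ge Q
    exact ⟨Q', fun n => (hQ ⟨n, rfl⟩).trans hQ'⟩
  -- a factor `M ≥ 1` is absorbed by the constant
  have habs : ∀ {M : ℕ}, 1 ≤ M → ∀ (C : ℕ) n,
      (C : ℝ) ^ (1 / q n) * M ≤ ((C * M ^ Q : ℕ) : ℝ) ^ (1 / q n) := fun {M} hM C n => by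
    have hM1 : (1 : ℝ) ≤ M := by exact_mod_cast hM
    push_cast
    rw [Real.mul_rpow (by positivity) (by positivity), ← Real.rpow_natCast,
      ← Real.rpow_mul (by positivity), mul_one_div]
    refine mul_le_mul_of_nonneg_left ?_ (by positivity)
    exact Real.self_le_rpow_of_one_le hM1 ((one_le_div (hq n)).2 (hQ n))
  constructor
  · intro h
    obtain ⟨L, N, hN, hle⟩ := exists_forall_row_le hp hpb b hb
      (fun L n => ((L + 1 : ℕ) : ℝ) ^ (1 / q n)) fun y hy => by
        obtain ⟨C, hC⟩ := h y hy
        obtain ⟨L, hL⟩ := exists_nat_ge C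
        refine ⟨L, fun n => ?_⟩
        have h1 : ‖∑' k, b n k * y k‖ ^ q n ≤ ((L + 1 : ℕ) : ℝ) := by
          refine ((hC ⟨n, rfl⟩).trans hL).trans ?_
          exact_mod_cast Nat.le_succ L
        rw [one_div]
        exact (Real.le_rpow_inv_iff_of_pos (norm_nonneg _) (by positivity) (hq n)).2 h1
    refine ⟨N, hN, (L + 1) * 2 ^ Q, Nat.succ_le_of_lt (by positivity), fun n K => ?_⟩
    refine (hle n K).trans (le_trans (le_of_eq ?_) (habs one_le_two (L + 1) n))
    rw [mul_comm, Nat.cast_ofNat]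
  · rintro ⟨N, hN, C, -, hC⟩ y hy
    obtain ⟨M, hM⟩ := exists_nat_norm_le_of_tendsto ((mem_maddoxC0_iff hp hpb).1 hy N hN)
    refine ⟨((C * (M + 1) ^ Q : ℕ) : ℝ), ?_⟩
    rintro _ ⟨n, rfl⟩
    -- `K = 0` leaves no head; `M + 1` replaces `M` because `habs` needs a factor at least `1`.
    have h1 := norm_tsum_mul_le hN (ε := ((M + 1 : ℕ) : ℝ)) (by positivity) (hC n) (K := 0)
      (y := y) fun k _ => by
        refine ((le_abs_self _).trans (hM k)).trans ?_
        exact_mod_cast Nat.le_succ M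
    rw [Finset.range_zero, Finset.sum_empty, zero_add] at h1
    have h2 := h1.trans (habs (Nat.succ_le_succ (Nat.zero_le M)) C n)
    rw [one_div] at h2
    exact (Real.le_rpow_inv_iff_of_pos (norm_nonneg _) (by positivity) (hq n)).1 h2

/-- The limits of the columns may replace the sequence in `CondRowConv`. -/
theorem condRowNull_sub_of_condRowConv {p q : ℕ → ℝ} (hq : ∀ k, 0 < q k)
    (hqb : BddAbove (Set.range q)) {b : ℕ → ℕ → 𝕜} {α : ℕ → 𝕜}
    (hcol : CondColNull q fun n k => b n k - α k) (hbdd : CondRowBdd p b)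
    (hconv : CondRowConv p q b) : CondRowNull p q fun n k => b n k - α k := by
  have htend : ∀ k, Tendsto (fun n => b n k) atTop (𝓝 (α k)) := fun k =>
    tendsto_sub_nhds_zero_iff.1 (tendsto_zero_of_mem_maddoxC0 hq hqb (hcol k))
  -- If `1 / q` is bounded, so is `L^{1/qₙ}`, and the bounded row sums suffice. Otherwise the two
  -- sequences `α` and `α'` must coincide.
  by_cases hQ : ∃ Q, ∀ n, 1 / q n ≤ Q
  · obtain ⟨Q, hQ⟩ := hQ
    obtain ⟨N, hN, C, hC⟩ := condRowBdd_iff.1 hbdd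
    have hC0 : 0 ≤ C := by simpa using hC 0 0
    refine condRowNull_iff.2 fun L hL => ⟨N, hN, (L : ℝ) ^ Q * (C + C), fun n K => ?_⟩
    exact mul_le_mul
      (Real.rpow_le_rpow_of_exponent_le (by exact_mod_cast hL) (hQ n))
      (sum_weighted_norm_sub_le (hC n) (sum_weighted_norm_le_of_tendsto htend hC) K)
      (Finset.sum_nonneg fun _ _ => by positivity) (by positivity)
  · obtain ⟨α', hα'⟩ := hconv
    have : α = α' := by
      funext k
      by_contra hne
      have hpos : 0 < ‖α k - α' k‖ := norm_pos_iff.2 (sub_ne_zero.2 hne)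
      -- `L = 3` exceeds `e`, so `3^{1/qₙ} ≥ 1/qₙ`; if `α k ≠ α' k`, the triangle inequality would
      -- then bound `1/qₙ`.
      obtain ⟨N, hN, C, hC⟩ := condRowNull_iff.1 hα' 3 (by norm_num)
      obtain ⟨M, hM⟩ := exists_nat_norm_le_of_tendsto
        ((mem_maddoxC0_iff hq hqb).1 (hcol k) 3 (by norm_num))
      have hN0 : 0 < (N : ℝ) ^ (-(1 / p k)) := Real.rpow_pos_of_pos (by exact_mod_cast hN) _
      refine hQ ⟨(M + C / (N : ℝ) ^ (-(1 / p k))) / ‖α k - α' k‖, fun n => ?_⟩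
      have h3 : 0 ≤ ((3 : ℕ) : ℝ) ^ (1 / q n) := by positivity
      have h1 : ((3 : ℕ) : ℝ) ^ (1 / q n) * ‖b n k - α' k‖ ≤ C / (N : ℝ) ^ (-(1 / p k)) := by
        rw [le_div_iff₀ hN0, mul_assoc]
        refine le_trans (mul_le_mul_of_nonneg_left ?_ h3) (hC n (k + 1))
        exact Finset.single_le_sum (f := fun k => ‖b n k - α' k‖ * (N : ℝ) ^ (-(1 / p k)))
          (fun _ _ => by positivity) (Finset.self_mem_range_succ k)
      have h2 : ((3 : ℕ) : ℝ) ^ (1 / q n) * ‖b n k - α k‖ ≤ M := (le_abs_self _).trans (hM n)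
      have h4 : ((3 : ℕ) : ℝ) ^ (1 / q n) * ‖α k - α' k‖
          ≤ M + C / (N : ℝ) ^ (-(1 / p k)) := by
        refine le_trans (mul_le_mul_of_nonneg_left ?_ h3)
          ((mul_add _ _ _).trans_le (add_le_add h2 h1))
        rw [norm_sub_rev (b n k)]
        exact norm_sub_le_norm_sub_add_norm_sub _ _ _
      have h5 : 1 / q n ≤ ((3 : ℕ) : ℝ) ^ (1 / q n) := by
        have h6 := Real.add_one_le_exp (1 / q n)
        have h7 : Real.exp (1 / q n) ≤ ((3 : ℕ) : ℝ) ^ (1 / q n) := by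
          rw [← Real.exp_one_rpow]
          exact Real.rpow_le_rpow (Real.exp_pos 1).le
            (by exact_mod_cast Real.exp_one_lt_three.le) (one_div_nonneg.2 (hq n).le)
        linarith
      rw [le_div_iff₀ hpos]
      exact (mul_le_mul_of_nonneg_right h5 hpos.le).trans h4
    rwa [this]

theorem forall_mem_maddoxC_iff {p q : ℕ → ℝ} (hp : ∀ k, 0 < p k)
    (hpb : BddAbove (Set.range p)) (hq : ∀ k, 0 < q k) (hqb : BddAbove (Set.range q))
    (b : ℕ → ℕ → 𝕜)
    (hb : ∀ n, ∃ N : ℕ, 1 ≤ N ∧ ∃ C, ∀ K,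
      ∑ k ∈ Finset.range K, ‖b n k‖ * (N : ℝ) ^ (-(1 / p k)) ≤ C) :
    (∀ y ∈ maddoxC0 𝕜 p, (fun n => ∑' k, b n k * y k) ∈ maddoxC 𝕜 q) ↔
      CondColConv q b ∧ CondRowBdd p b ∧ CondRowConv p q b := by
  have hlim : ∀ {z : ℕ → 𝕜} {l : 𝕜}, (fun n => z n - l) ∈ maddoxC0 𝕜 q →
      Tendsto z atTop (𝓝 l) := fun hz =>
    tendsto_sub_nhds_zero_iff.1 (tendsto_zero_of_mem_maddoxC0 hq hqb hz)
  -- with `α` the limits of the columns, `b - α` maps `y` to `b y - ∑ αₖ yₖ`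
  have hdiff : ∀ {α : ℕ → 𝕜} {N : ℕ} {C : ℝ}, 1 ≤ N →
      (CondColNull q fun n k => b n k - α k) →
      (∀ n K, ∑ k ∈ Finset.range K, ‖b n k‖ * (N : ℝ) ^ (-(1 / p k)) ≤ C) →
      ((∀ n K, ∑ k ∈ Finset.range K, ‖b n k - α k‖ * (N : ℝ) ^ (-(1 / p k)) ≤ C + C) ∧
        ∀ y ∈ maddoxC0 𝕜 p,
          Tendsto (fun n => ∑' k, b n k * y k) atTop (𝓝 (∑' k, α k * y k)) ∧
          ∀ n, ∑' k, (b n k - α k) * y k = ∑' k, b n k * y k - ∑' k, α k * y k) := by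
    intro α N C hN hcol hC
    have htend : ∀ k, Tendsto (fun n => b n k) atTop (𝓝 (α k)) := fun k => hlim (hcol k)
    have hα := sum_weighted_norm_le_of_tendsto htend hC
    refine ⟨fun n => sum_weighted_norm_sub_le (hC n) hα, fun y hy =>
      ⟨tendsto_tsum_mul hp hpb hy hN htend hC, fun n => ?_⟩⟩
    rw [← (summable_mul_of_row_le hp hpb hy hN (hC n)).tsum_sub
      (summable_mul_of_row_le hp hpb hy hN hα)]
    exact tsum_congr fun k => sub_mul _ _ _
  constructor
  · intro h
    have hcol : CondColConv q b := by
      have : ∀ k, ∃ l : 𝕜, (fun n => b n k - l) ∈ maddoxC0 𝕜 q := fun k => by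
        obtain ⟨l, hl⟩ := h _ (single_mem_maddoxC0 hp k)
        simp only [tsum_mul_single] at hl
        exact ⟨l, hl⟩
      choose α hα using this
      exact ⟨α, hα⟩
    have hrow := exists_row_le_of_tendsto hp hpb b hb fun y hy => by
      obtain ⟨l, hl⟩ := h y hy
      exact ⟨l, hlim hl⟩
    refine ⟨hcol, condRowBdd_iff.2 hrow, ?_⟩
    obtain ⟨α, hα⟩ := hcol
    obtain ⟨N, hN, C, hC⟩ := hrow
    obtain ⟨hsub, hy⟩ := hdiff hN hα hC
    refine ⟨α, ((forall_mem_maddoxC0_iff hp hpb hq hqb _ fun n => ⟨N, hN, _, hsub n⟩).1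
      fun y hy' => ?_).2⟩
    obtain ⟨l, hl⟩ := h y hy'
    -- The limit in `c(q)` is also an ordinary limit, hence equals `∑ αₖ yₖ`; so `b - α` maps
    -- `c₀(p)` into `c₀(q)`.
    have hl' := tendsto_nhds_unique (hlim hl) (hy y hy').1
    simp only [(hy y hy').2, ← hl']
    exact hl
  · rintro ⟨⟨α, hα⟩, hbdd, hconv⟩ y hy
    have hnull := condRowNull_sub_of_condRowConv hq hqb hα hbdd hconv
    obtain ⟨N, hN, C, hC⟩ := condRowBdd_iff.1 hbdd
    obtain ⟨hsub, hy'⟩ := hdiff hN hα hC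
    have := (forall_mem_maddoxC0_iff hp hpb hq hqb _ fun n => ⟨N, hN, _, hsub n⟩).2
      ⟨hα, hnull⟩ y hy
    simp only [(hy' y hy).2] at this
    exact ⟨_, this⟩

end GeneralizedMeans

theorem corollary4p1 {𝕜 : Type*} [RCLike 𝕜]
    (r s t : ℕ → 𝕜) (hr : ∀ n, r n ≠ 0) (hs : s 0 ≠ 0) (ht : ∀ n, t n ≠ 0)
    (p q : ℕ → ℝ) (hp : ∀ k, 0 < p k) (hpb : BddAbove (Set.range p))
    (hq : ∀ k, 0 < q k) (hqb : BddAbove (Set.range q))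
    (A : ℕ → ℕ → 𝕜) :
    (A ∈ matrixClass (meanDiffSpace r s t (maddoxC0 𝕜 p)) (maddoxC0 𝕜 q) ↔
      CondColNull q (Etilde r s t A) ∧ CondRowNull p q (Etilde r s t A) ∧
        ∀ n, A n ∈ betaDual (meanDiffSpace r s t (maddoxC0 𝕜 p))) ∧
    (A ∈ matrixClass (meanDiffSpace r s t (maddoxC0 𝕜 p)) (maddoxC 𝕜 q) ↔
      CondColConv q (Etilde r s t A) ∧ CondRowBdd p (Etilde r s t A) ∧
        CondRowConv p q (Etilde r s t A) ∧
        ∀ n, A n ∈ betaDual (meanDiffSpace r s t (maddoxC0 𝕜 p))) ∧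
    (A ∈ matrixClass (meanDiffSpace r s t (maddoxC0 𝕜 p)) (maddoxLinf 𝕜 q) ↔
      CondRowPowBdd p q (Etilde r s t A) ∧
        ∀ n, A n ∈ betaDual (meanDiffSpace r s t (maddoxC0 𝕜 p))) := by
  -- Either side of the equivalence puts the rows of `A` in the β-dual, so `Etilde` consists of
  -- genuine limits and its rows are weighted summable wherever `P` has to be compared with the
  -- mapping property.
  have key : ∀ (V : Set (ℕ → 𝕜)) (P : Prop),
      ((∀ n, ∃ N : ℕ, 1 ≤ N ∧ ∃ C, ∀ K, ∑ k ∈ Finset.range K,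
          ‖Etilde r s t A n k‖ * (N : ℝ) ^ (-(1 / p k)) ≤ C) →
        ((∀ y ∈ maddoxC0 𝕜 p, (fun n => ∑' k, Etilde r s t A n k * y k) ∈ V) ↔ P)) →
      (A ∈ matrixClass (meanDiffSpace r s t (maddoxC0 𝕜 p)) V ↔
        P ∧ ∀ n, A n ∈ betaDual (meanDiffSpace r s t (maddoxC0 𝕜 p))) := by
    intro V P h
    have hiff := fun hA : ∀ n, A n ∈ betaDual (meanDiffSpace r s t (maddoxC0 𝕜 p)) =>
      (mem_matrixClass_iff r s t hr hs ht hp hpb hA V).trans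
        (h fun n => (betaDual_spec r s t hr hs ht hp hpb (hA n)
          (tendsto_Emat r s t hr hs ht hp (hA n))).1)
    exact ⟨fun hA => ⟨(hiff (mem_betaDual_of_mem_matrixClass hA)).1 hA,
      mem_betaDual_of_mem_matrixClass hA⟩, fun ⟨hP, hA⟩ => (hiff hA).2 hP⟩
  refine ⟨?_, ?_, ?_⟩
  · rw [key _ _ (forall_mem_maddoxC0_iff hp hpb hq hqb _), and_assoc]
  · rw [key _ _ (forall_mem_maddoxC_iff hp hpb hq hqb _), and_assoc, and_assoc]
  · exact key _ _ (forall_mem_maddoxLinf_iff hp hpb hq hqb _)
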